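/- Let $A$ be an arbitrary alphabet and let $A^*$ be the free monoid on $A$, with empty word $1$. For $w\in A^*$ let $w^{(+)}$ be its palindromic closure, the unique shortest palindrome having $w$ as a prefix. Let $\mathrm{Pal}:A^*\to A^*$ be the map defined by $\mathrm{Pal}(1)=1$ and $\mathrm{Pal}(wa)=(\mathrm{Pal}(w)a)^{(+)}$ for $w\in A^*$, $a\in A$. For a language $L\subset A^*$ and $u\in A^*$, let $u^{-1}L=\{v\in A^*\mid uv\in L\}$. A nonempty residual $u^{-1}L$ is called special if $u=1$, or $u\in L$, or $u^{-1}L$ contains two words beginning with different letters. The minimal compact automaton of $L$ has the special residuals of $L$ as states, $L$ as initial state, and the $u^{-1}L$ with $u\in L$ as terminal states. Its transitions are the triples $(p,v,q)$ with $p,q$ states and $v$ a nonempty word such that, for some $u\in A^*$, $p=u^{-1}L$, $q=(uv)^{-1}L$, and there is no factorization $v=v'v''$ with $v',v''$ nonempty such that $(uv')^{-1}L$ is a special residual. For $u\in A^*$ let $\mathcal S_c(u)$ denote the minimal compact automaton of the set of all suffixes of $\mathrm{Pal}(u)$ (including the empty one). Let $u\in A^*$ be of length $n$, and for any $a\in A$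 let $p_a(u)$ be the position (counted from $1$) of the rightmost occurrence of $a$ in $u$, with $p_a(u)=0$ when $a$ does not occur in $u$. Then the number of states of $\mathcal S_c(u)$ is $n+1$, and its number of transitions is $\sum_{a\in A}p_a(u)$ (a sum with finitely many nonzero terms). -/

import Mathlib

/-!
Words over an alphabet `A` are lists `List A`; the empty word `1` is `[]`.
-/

namespace PalAutomaton

universe u v

/-! ### Iterated palindromic closure -/

/-- The palindromic closure of `w`: if `w = y z` with `z` the longest palindromic suffix of `w`,
it is `y z ỹ`. By `palClosure_eq_iff` below, this is the unique
shortest palindrome having `w` as a prefix. -/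
def palClosure {A : Type u} [DecidableEq A] : List A → List A
  | [] => []
  | a :: w => if (a :: w).reverse = a :: w then a :: w else a :: (palClosure w ++ [a])

/-- `p` is a shortest palindrome among those having `w` as a prefix. -/
def IsShortestPalExtension {A : Type u} (w p : List A) : Prop :=
  p.reverse = p ∧ w <+: p ∧ ∀ q : List A, q.reverse = q → w <+: q → p.length ≤ q.length

theorem reverse_palClosure {A : Type u} [DecidableEq A] (w : List A) :
    (palClosure w).reverse = palClosure w := by
  induction w with
  | nil => rfl
  | cons a w ih =>
    unfold palClosure
    split_ifs with h
    · exact h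
    · simp [ih]

theorem prefix_palClosure {A : Type u} [DecidableEq A] (w : List A) : w <+: palClosure w := by
  induction w with
  | nil => simp [palClosure]
  | cons a w ih =>
    unfold palClosure
    split_ifs with h
    · exact List.prefix_rfl
    · rw [List.cons_prefix_cons]
      exact ⟨rfl, ih.trans (List.prefix_append _ _)⟩

theorem palClosure_minimal {A : Type u} [DecidableEq A] (w : List A) :
    ∀ q : List A, q.reverse = q → w <+: q → (palClosure w).length ≤ q.length ∧
      (q.length ≤ (palClosure w).length → q = palClosure w) := by
  induction w with
  | nil =>
    intro q _ _
    simp [palClosure]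
  | cons a w ih =>
    intro q hq hw
    unfold palClosure
    split_ifs with h
    · exact ⟨hw.length_le, fun hl => (hw.eq_of_length_le hl).symm⟩
    · obtain ⟨t, rfl⟩ := hw
      rw [List.cons_append] at hq ⊢
      rcases List.eq_nil_or_concat (w ++ t) with h0 | ⟨m, b, hm⟩
      · exfalso
        have : w = [] := (List.append_eq_nil_iff.mp h0).1
        subst this
        simp at h
      · rw [List.concat_eq_append] at hm
        rw [hm] at hq ⊢
        simp only [List.reverse_cons, List.reverse_append, List.reverse_nil, List.nil_append,
          List.cons_append, List.cons.injEq] at hq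
        obtain ⟨hba, hq⟩ := hq
        subst hba
        have hmr : m.reverse = m := List.append_cancel_right hq
        have hwm : w <+: m := by
          have hw' : w <+: m ++ [b] := ⟨t, hm⟩
          rcases List.prefix_concat_iff.mp hw' with h1 | h1
          · exfalso
            apply h
            rw [h1]
            simp [hmr]
          · exact h1
        obtain ⟨h1, h2⟩ := ih m hmr hwm
        refine ⟨by simpa using h1, fun hl => ?_⟩
        rw [h2 (by simpa using hl)]

theorem palClosure_eq_iff {A : Type u} [DecidableEq A] (w p : List A) :
    palClosure w = p ↔ IsShortestPalExtension w p := by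
  constructor
  · rintro rfl
    exact ⟨reverse_palClosure w, prefix_palClosure w,
      fun q hq hw => (palClosure_minimal w q hq hw).1⟩
  · rintro ⟨hp, hw, hmin⟩
    exact ((palClosure_minimal w p hp hw).2
      (hmin _ (reverse_palClosure w) (prefix_palClosure w))).symm

/-- The iterated palindromic closure: `Pal 1 = 1` and `Pal (w a) = (Pal w a)^(+)`. -/
def Pal {A : Type u} [DecidableEq A] (w : List A) : List A :=
  w.foldl (fun p a => palClosure (p ++ [a])) []

theorem Pal_nil {A : Type u} [DecidableEq A] : Pal ([] : List A) = [] := rfl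

theorem Pal_append_singleton {A : Type u} [DecidableEq A] (w : List A) (a : A) :
    Pal (w ++ [a]) = palClosure (Pal w ++ [a]) := by
  simp [Pal]

/-! ### Compact automata -/

/-- A compact automaton `(Q, E, I, T)` over `A`, with `E ⊆ Q × A⁺ × Q` and `I, T ⊆ Q`. -/
structure CompactAutomaton (A : Type u) (Q : Type v) where
  edges : Set (Q × List A × Q)
  label_ne_nil : ∀ e ∈ edges, e.2.1 ≠ []
  initial : Set Q
  terminal : Set Q

/-- The number of states. -/
noncomputable def CompactAutomaton.numStates {A : Type u} {Q : Type v}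
    (_M : CompactAutomaton A Q) : ℕ∞ :=
  ENat.card Q

/-- The number of transitions (edges). -/
noncomputable def CompactAutomaton.numTransitions {A : Type u} {Q : Type v}
    (M : CompactAutomaton A Q) : ℕ∞ :=
  M.edges.encard

/-- `R` is a special residual of `L`: a nonempty residual `u⁻¹L = {v | u v ∈ L}` such that `u = 1`,
or `u ∈ L`, or `u⁻¹L` contains two words beginning with different letters. -/
def IsSpecialResidual {A : Type u} (L R : Language A) : Prop :=
  (∃ v, v ∈ R) ∧ ∃ u : List A, R = L.leftQuotient u ∧
    (u = [] ∨ u ∈ L ∨ ∃ (a b : A) (v w : List A), a ≠ b ∧ a :: v ∈ R ∧ b :: w ∈ R)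

/-- The minimal compact automaton of `L`: its states are the special residuals of `L`, its initial
state is `L`, its terminal states are the `u⁻¹L` with `u ∈ L`, and its edges are
the `(u⁻¹L, v, (uv)⁻¹L)` with `v` nonempty such that there is no factorization `v = v'v''` with
`v', v''` nonempty and `(uv')⁻¹L` a special residual. -/
def minimalCompactAutomaton {A : Type u} (L : Language A) :
    CompactAutomaton A {R : Language A // IsSpecialResidual L R} where
  edges := {e | e.2.1 ≠ [] ∧ ∃ u : List A,
    e.1.1 = L.leftQuotient u ∧ e.2.2.1 = L.leftQuotient (u ++ e.2.1) ∧
    ¬ ∃ v' v'' : List A, v' ≠ [] ∧ v'' ≠ [] ∧ e.2.1 = v' ++ v'' ∧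
      IsSpecialResidual L (L.leftQuotient (u ++ v'))}
  label_ne_nil := fun _ he => he.1
  initial := {R | R.1 = L}
  terminal := {R | ∃ u : List A, u ∈ L ∧ R.1 = L.leftQuotient u}

/-- The language of all suffixes of `w` (including `1` and `w`). -/
def suffixLanguage {A : Type u} (w : List A) : Language A :=
  {s | s <:+ w}

/-- `S_c(u)`: the minimal compact automaton of the set of suffixes of `Pal u`. -/
def compactSuffixAutomaton {A : Type u} [DecidableEq A] (w : List A) :
    CompactAutomaton A {R : Language A // IsSpecialResidual (suffixLanguage (Pal w)) R} :=
  minimalCompactAutomaton (suffixLanguage (Pal w))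

/-! ### Position of the rightmost occurrence -/

/-- The position (counted from `1`) of the rightmost occurrence of `a` in `w`, and `0` if `a` does
not occur in `w`. -/
def lastPos {A : Type u} [DecidableEq A] (a : A) (w : List A) : ℕ :=
  {j ∈ Finset.range w.length | w[j]? = some a}.sup (fun j => j + 1)

theorem lastPos_eq_zero {A : Type u} [DecidableEq A] {a : A} {w : List A} (h : a ∉ w) :
    lastPos a w = 0 := by
  unfold lastPos
  rw [Finset.filter_false_of_mem]
  · rfl
  · intro j _ hj
    exact h (List.mem_of_getElem? hj)

theorem finite_support_lastPos {A : Type u} [DecidableEq A] (w : List A) :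
    (Function.support fun a => lastPos a w).Finite := by
  refine w.toFinset.finite_toSet.subset fun a ha => ?_
  by_contra h
  exact ha (lastPos_eq_zero (by simpa using h))

end PalAutomaton

namespace PalAutomaton

universe u

variable {A : Type u}

/-! Let `P = Pal u` and let `L` be its set of suffixes. Right special factors of `P` are suffixes of
`P`, so every special residual is `x⁻¹L` for a suffix `x`. Every occurrence of `x` extends to the
left to the shortest palindromic suffix `T` with `|T| ≥ |x|`, hence `x⁻¹L = T⁻¹L`. Palindromic
suffixes of `P` are its palindromic prefixes `Pal (u.take k)`, `k ≤ n`, and their residuals are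
distinct: `n + 1` states. A transition amounts to a state together with the first letter of a word
in it. From state `k` the letter `c` is possible iff `Pal (u.take k) ++ [c]` is a factor of `P`,
that is, iff `k < p_c(u)` (`Pal_take_append_isInfix_iff`); summing over `c` gives the count. The
factor properties needed, `IsStandardPal`, pass from `P` to `(Pa)^(+)` because the longest
palindromic suffix of `Pa` does not occur in `P`. -/

theorem isSuffix_of_isPrefix_of_reverse_eq {T P : List A} (hT : T.reverse = T)
    (hP : P.reverse = P) (h : T <+: P) : T <:+ P := by
  rw [← hT, ← hP]
  exact List.reverse_suffix.mpr h

theorem isPrefix_of_isSuffix_of_reverse_eq {T P : List A} (hT : T.reverse = T)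
    (hP : P.reverse = P) (h : T <:+ P) : T <+: P := by
  rw [← hT, ← hP]
  exact List.reverse_prefix.mpr h

theorem isInfix_reverse_of_reverse_eq {x P : List A} (hP : P.reverse = P) (h : x <:+: P) :
    x.reverse <:+: P := by
  rw [← hP]
  exact List.reverse_infix.mpr h

theorem reverse_eq_of_isPrefix_of_isSuffix {y P : List A} (hP : P.reverse = P)
    (h₁ : y <+: P) (h₂ : y <:+ P) : y.reverse = y := by
  have h₃ : y.reverse <+: P := by
    rw [← hP]
    exact List.reverse_prefix.mpr h₂
  exact (List.prefix_of_prefix_length_le h₃ h₁ (by simp)).eq_of_length (by simp)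

/-- The properties of iterated palindromic closures that are propagated by the map
`P ↦ (P a)^(+)`: such a `P` is a palindrome, its right special factors are suffixes, and if a
palindromic prefix `T` is followed by the letter `b` somewhere in `P`, then some
palindromic prefix at least as long as `T` is followed by `b` as a prefix of `P`. -/
structure IsStandardPal (P : List A) : Prop where
  pal : P.reverse = P
  isSuffix_of_special : ∀ (x : List A) (c d : A), c ≠ d → x ++ [c] <:+: P → x ++ [d] <:+: P →
    x <:+ P
  exists_palPrefix : ∀ (T : List A) (b : A), T.reverse = T → T <+: P → T ++ [b] <:+: P →
    ∃ T' : List A, T'.reverse = T' ∧ T.length ≤ T'.length ∧ T' ++ [b] <+: P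

theorem isStandardPal_nil : IsStandardPal ([] : List A) where
  pal := rfl
  isSuffix_of_special x c d _ h _ := by simp at h
  exists_palPrefix T b _ _ h := by simp at h

theorem IsStandardPal.isPrefix_of_special {P : List A} (h : IsStandardPal P) {x : List A}
    {c d : A} (hcd : c ≠ d) (hc : c :: x <:+: P) (hd : d :: x <:+: P) : x <+: P := by
  have h₁ := h.isSuffix_of_special x.reverse c d hcd
    (by simpa using isInfix_reverse_of_reverse_eq h.pal hc)
    (by simpa using isInfix_reverse_of_reverse_eq h.pal hd)
  rw [← h.pal] at h₁
  exact List.reverse_suffix.mp h₁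

/-- Every occurrence of a suffix `y` of `P` extends to the left to an occurrence of the shortest
palindromic suffix of `P` which is at least as long as `y`. -/
theorem IsStandardPal.isSuffix_append {P T : List A} (h : IsStandardPal P) (hTP : T <:+ P)
    (k : ℕ) : ∀ y : List A, y.length + k = T.length → y <:+ T →
    (∀ S : List A, S.reverse = S → S <:+ P → y.length ≤ S.length → T.length ≤ S.length) →
    ∀ α β : List A, α ++ y ++ β = P → T <:+ α ++ y := by
  induction k with
  | zero =>
    intro y hk hy _ α β _
    rw [hy.eq_of_length (by simpa using hk)]
    exact List.suffix_append _ _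
  | succ k ih =>
    intro y hk hy hmin α β hP
    -- A prefix and suffix of a palindrome is a palindrome; such a `y`, shorter than `T`, would
    -- contradict the minimality of `T`.
    have hnp : ¬ y <+: P := by
      intro hp
      have := hmin y (reverse_eq_of_isPrefix_of_isSuffix h.pal hp (hy.trans hTP))
        (hy.trans hTP) le_rfl
      omega
    obtain ⟨t, ht⟩ := hy
    rcases List.eq_nil_or_concat t with rfl | ⟨t, c, rfl⟩
    · subst ht
      simp at hk
    rcases List.eq_nil_or_concat α with rfl | ⟨α, d, rfl⟩
    · exact absurd ⟨β, by simpa using hP⟩ hnp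
    rw [List.concat_eq_append] at *
    have hcy : c :: y <:+ T := ⟨t, by simpa using ht⟩
    by_cases hcd : c = d
    · subst hcd
      have := ih (c :: y) (by simp; omega) hcy
        (fun S h₁ h₂ h₃ => hmin S h₁ h₂ (by simp at h₃; omega)) α β (by simpa using hP)
      simpa using this
    -- Two different letters to the left make `y` left special, hence a prefix.
    · exact absurd (h.isPrefix_of_special hcd (hcy.trans hTP).isInfix
        ⟨α, β, by simpa using hP⟩) hnp

/-- The shortest palindromic suffix of a palindrome among those of length at least `m`. -/
theorem exists_shortest_palSuffix {P : List A} (hP : P.reverse = P) {m : ℕ}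
    (hm : m ≤ P.length) : ∃ T : List A, T.reverse = T ∧ T <:+ P ∧ m ≤ T.length ∧
      ∀ S : List A, S.reverse = S → S <:+ P → m ≤ S.length → T.length ≤ S.length := by
  classical
  have hex : ∃ l, ∃ T : List A, T.length = l ∧ T.reverse = T ∧ T <:+ P ∧ m ≤ T.length :=
    ⟨_, P, rfl, hP, List.suffix_rfl, hm⟩
  obtain ⟨T, hl, h₁, h₂, h₃⟩ := Nat.find_spec hex
  refine ⟨T, h₁, h₂, h₃, fun S s₁ s₂ s₃ => ?_⟩
  rw [hl]
  exact Nat.find_min' hex ⟨S, rfl, s₁, s₂, s₃⟩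

theorem IsStandardPal.exists_isSuffix_append {P x : List A} (h : IsStandardPal P)
    (hx : x <:+ P) : ∃ T : List A, T.reverse = T ∧ T <:+ P ∧ x <:+ T ∧
      ∀ α β : List A, α ++ x ++ β = P → T <:+ α ++ x := by
  obtain ⟨T, h₁, h₂, h₃, h₄⟩ := exists_shortest_palSuffix h.pal hx.length_le
  have hxT : x <:+ T := List.suffix_of_suffix_length_le hx h₂ h₃
  exact ⟨T, h₁, h₂, hxT, h.isSuffix_append h₂ (T.length - x.length) x (by omega) hxT h₄⟩

/-- The longest palindromic suffix of `P a` does not occur in `P`. -/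
theorem IsStandardPal.not_isInfix {P Q : List A} {a : A} (h : IsStandardPal P)
    (hQ : Q.reverse = Q) (hQs : Q <:+ P ++ [a])
    (hmax : ∀ S : List A, S.reverse = S → S <:+ P ++ [a] → S.length ≤ Q.length) :
    ¬ Q <:+: P := by
  intro hin
  -- Mirrored, `T'a` is a suffix `aT'` of `P`, so `aT'a` is a palindromic suffix of `Pa`.
  have key : ∀ T' : List A, T'.reverse = T' → T' ++ [a] <+: P → T'.length + 2 ≤ Q.length := by
    intro T' h₁ h₂
    have h₃ : a :: T' <:+ P := by
      rw [← h.pal]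
      have := List.reverse_suffix.mpr h₂
      simpa [h₁] using this
    obtain ⟨s, hs⟩ := h₃
    have := hmax (a :: T' ++ [a]) (by simp [h₁]) ⟨s, by simp [← hs]⟩
    simpa [Nat.succ_le_iff] using this
  have hne : 1 ≤ Q.length := by
    simpa using hmax [a] rfl (List.suffix_append _ _)
  rcases List.eq_nil_or_concat Q with rfl | ⟨Q', b, rfl⟩
  · simp at hne
  rw [List.concat_eq_append] at *
  obtain ⟨z, hz⟩ := hQs
  rw [← List.append_assoc] at hz
  obtain ⟨hzP, hba⟩ := List.append_inj' hz rfl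
  obtain rfl : b = a := by simpa using hba
  cases Q' with
  | nil =>
    obtain ⟨T', h₁, -, h₃⟩ := h.exists_palPrefix [] b rfl List.nil_prefix hin
    have := key T' h₁ h₃
    simp at this
  | cons c R =>
    have hc : c = b := by
      simp at hQ
      exact hQ.1.symm
    subst hc
    -- An occurrence of `Q = cRc` in `P` extends to one of `Tc` with `|T| ≥ |cR|`; then
    -- `exists_palPrefix` and `key` give a palindromic suffix of `Pc` longer than `Q`.
    obtain ⟨T, t₁, t₂, t₃, t₄⟩ := h.exists_isSuffix_append (x := c :: R) ⟨z, hzP⟩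
    obtain ⟨α, β, hαβ⟩ := hin
    obtain ⟨s, hs⟩ := t₄ α ([c] ++ β) (by simpa using hαβ)
    obtain ⟨T', h₁, h₂, h₃⟩ := h.exists_palPrefix T c t₁
      (isPrefix_of_isSuffix_of_reverse_eq t₁ h.pal t₂)
      ⟨s, β, by rw [← List.append_assoc, hs]; simpa using hαβ⟩
    have := key T' h₁ h₃
    have := t₃.length_le
    simp at *
    omega

/-! ### Factors of a palindromic closure -/

section Closure

variable [DecidableEq A]

theorem exists_palClosure_eq (w : List A) : ∃ z Q : List A, w = z ++ Q ∧ Q.reverse = Q ∧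
    palClosure w = z ++ Q ++ z.reverse ∧
    ∀ S : List A, S.reverse = S → S <:+ w → S.length ≤ Q.length := by
  induction w with
  | nil => exact ⟨[], [], by simp [palClosure]⟩
  | cons a w ih =>
    by_cases h : (a :: w).reverse = a :: w
    · refine ⟨[], a :: w, rfl, h, ?_, fun S _ hS => hS.length_le⟩
      rw [palClosure, if_pos h]
      simp
    · obtain ⟨z, Q, h₁, h₂, h₃, h₄⟩ := ih
      refine ⟨a :: z, Q, by simp [h₁], h₂, ?_, fun S hS hSw => ?_⟩
      · rw [palClosure, if_neg h, h₃]
        simp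
      · rcases List.suffix_cons_iff.mp hSw with rfl | hSw
        · exact absurd hS h
        · exact h₄ S hS hSw

theorem palPrefix_palClosure {P T : List A} {a : A} (hT : T.reverse = T)
    (h : T <+: palClosure (P ++ [a])) : T <+: P ∨ T = palClosure (P ++ [a]) := by
  rcases le_or_gt T.length P.length with hl | hl
  · exact Or.inl (List.prefix_of_prefix_length_le h
      ((List.prefix_append P [a]).trans (prefix_palClosure _)) hl)
  · have h₁ : P ++ [a] <+: T :=
      List.prefix_of_prefix_length_le (prefix_palClosure _) h (by simpa using hl)
    exact Or.inr ((palClosure_minimal _ T hT h₁).2 h.length_le)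

end Closure

/-- An occurrence of `x` in the closure `W = z Q z̃` of `P a` lies in one of the
two occurrences of `P`, or covers the central occurrence of `Q`. -/
theorem isInfix_or_covers {P z Q W α x β : List A} {a : A} (h₁ : W = P ++ a :: z.reverse)
    (h₂ : W = z ++ a :: P) (h₃ : W = z ++ Q ++ z.reverse) (hW : α ++ x ++ β = W) :
    x <:+: P ∨ ∃ x₁ x₂, x = x₁ ++ Q ++ x₂ ∧ z = α ++ x₁ := by
  rcases lt_or_ge z.length β.length with hβ | hβ
  · left
    have hp : α ++ x <+: P := by
      refine List.prefix_of_prefix_length_le ⟨β, hW⟩ ⟨_, h₁.symm⟩ ?_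
      have := congrArg List.length (hW.trans h₁)
      simp at this ⊢
      omega
    exact (List.suffix_append α x).isInfix.trans hp.isInfix
  rcases lt_or_ge z.length α.length with hα | hα
  · left
    have hp : x ++ β <:+ P := by
      refine List.suffix_of_suffix_length_le (l₃ := W) ⟨α, by simpa using hW⟩
        ⟨z ++ [a], by simp [h₂]⟩ ?_
      have := congrArg List.length (hW.trans h₂)
      simp at this ⊢
      omega
    exact (List.prefix_append x β).isInfix.trans hp.isInfix
  · right
    obtain ⟨x₁, hx₁⟩ : α <+: z := List.prefix_of_prefix_length_le (l₃ := W)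
      ⟨x ++ β, by simpa using hW⟩ ⟨Q ++ z.reverse, by simp [h₃]⟩ hα
    obtain ⟨x₂, hx₂⟩ : β <:+ z.reverse := List.suffix_of_suffix_length_le (l₃ := W)
      ⟨α ++ x, hW⟩ ⟨z ++ Q, h₃.symm⟩ (by simpa using hβ)
    refine ⟨x₁, x₂, ?_, hx₁.symm⟩
    rw [← hx₂, ← hW] at h₃
    nth_rw 1 [← hx₁] at h₃
    have h₄ : α ++ (x ++ β) = α ++ (x₁ ++ Q ++ x₂ ++ β) := by simpa using h₃
    exact List.append_cancel_right (List.append_cancel_left h₄)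

/-- Right special factors of the closure one of whose extensions is not a factor of `P`. -/
theorem isSuffix_of_special_of_not_isInfix {P z Q W x : List A} {a c d : A}
    (h₁ : W = P ++ a :: z.reverse) (h₂ : W = z ++ a :: P) (h₃ : W = z ++ Q ++ z.reverse)
    (hQ : z ++ Q = P ++ [a]) (hQP : ¬ Q <:+: P) (hcd : c ≠ d)
    (hc : x ++ [c] <:+: W) (hd : x ++ [d] <:+: W)
    (hcP : ¬ x ++ [c] <:+: P) : x <:+ P := by
  obtain ⟨α, β, hαβ⟩ := hc
  obtain ⟨x₁, x₂, hx, hz⟩ := (isInfix_or_covers h₁ h₂ h₃ hαβ).resolve_left hcP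
  rcases List.eq_nil_or_concat x₂ with rfl | ⟨x₂, e, rfl⟩
  -- Here `xc` ends with the central `Q`, that is, just after the prefix `P` and the letter `a`.
  · refine ⟨α, ?_⟩
    have : (α ++ x) ++ [c] = P ++ [a] := by
      rw [← hQ, hz]
      simpa using hx
    exact (List.append_inj' this rfl).1
  · exfalso
    have hx' : x = x₁ ++ Q ++ x₂ := by
      have : x ++ [c] = (x₁ ++ Q ++ x₂) ++ [e] := by simpa using hx
      exact (List.append_inj' this rfl).1
    obtain ⟨α', β', hαβ'⟩ := hd
    have hW : (α' ++ x₁) ++ Q ++ (x₂ ++ [d] ++ β') = W := by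
      rw [← hαβ', hx']
      simp
    -- `Q` occurs only once in `W`, so both occurrences of `x` start at the same place, and `c = d`.
    obtain ⟨e₁, e₂, he, hze⟩ := (isInfix_or_covers h₁ h₂ h₃ hW).resolve_left hQP
    have hl := congrArg List.length he
    simp at hl
    obtain rfl : e₁ = [] := List.length_eq_zero_iff.mp (by omega)
    have hα : α' = α := by
      rw [hz] at hze
      simpa using hze.symm
    subst hα
    have := hαβ.trans hαβ'.symm
    simp at this
    exact hcd this.1

/-! ### Iterated closure: invariants, palindromic prefixes, extensions by a letter -/

section IteratedClosure

variable [DecidableEq A]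

theorem IsStandardPal.palClosure {P : List A} (h : IsStandardPal P) (a : A) :
    IsStandardPal (palClosure (P ++ [a])) := by
  have hWpal := reverse_palClosure (P ++ [a])
  have hpre := fun T => palPrefix_palClosure (P := P) (T := T) (a := a)
  have hPW := prefix_palClosure (P ++ [a])
  obtain ⟨z, Q, hQ, hQpal, h₃, hmax⟩ := exists_palClosure_eq (P ++ [a])
  set W := PalAutomaton.palClosure (P ++ [a])
  have hQP : ¬ Q <:+: P := h.not_isInfix hQpal ⟨z, hQ.symm⟩ hmax
  have hQ₀ : Q ≠ [] := by
    rintro rfl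
    exact hQP List.nil_infix
  have h₁ : W = P ++ a :: z.reverse := by
    rw [h₃, ← hQ]
    simp
  have h₂ : W = z ++ a :: P := by
    rw [← hWpal, h₁]
    simp [h.pal]
  have hPs : P <:+ W := ⟨z ++ [a], by simp [h₂]⟩
  refine ⟨hWpal, fun x c d hcd hc hd => ?_, fun T b hT hTW hb => ?_⟩
  · by_cases hcP : x ++ [c] <:+: P
    · by_cases hdP : x ++ [d] <:+: P
      · exact (h.isSuffix_of_special x c d hcd hcP hdP).trans hPs
      · exact (isSuffix_of_special_of_not_isInfix h₁ h₂ h₃ hQ.symm hQP hcd.symm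
          hd hc hdP).trans hPs
    · exact (isSuffix_of_special_of_not_isInfix h₁ h₂ h₃ hQ.symm hQP hcd
          hc hd hcP).trans hPs
  · rcases hpre T hT hTW with hTP | rfl
    swap
    · have := hb.length_le
      simp at this
    by_cases hbP : T ++ [b] <:+: P
    · obtain ⟨T', t₁, t₂, t₃⟩ := h.exists_palPrefix T b hT hTP hbP
      exact ⟨T', t₁, t₂, t₃.trans ((List.prefix_append _ _).trans hPW)⟩
    -- A new factor `Tb` covers `Q`, while `T`, being a factor of `P`, does not contain `Q`. So `Tb`
    -- ends with `Q`, which forces `b = a`, and then `P` itself serves as `T'`.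
    · by_cases hba : b = a
      · subst hba
        exact ⟨P, h.pal, hTP.length_le, hPW⟩
      · exfalso
        obtain ⟨α, β, hαβ⟩ := hb
        obtain ⟨x₁, x₂, hx, -⟩ := (isInfix_or_covers h₁ h₂ h₃ hαβ).resolve_left hbP
        rcases List.eq_nil_or_concat x₂ with rfl | ⟨x₂, e, rfl⟩
        · have e₁ := congrArg List.getLast? hx
          have e₂ := congrArg List.getLast? hQ
          simp [List.getLast?_append] at e₁ e₂
          rcases List.eq_nil_or_concat Q with rfl | ⟨Q', e, rfl⟩
          · exact hQ₀ rfl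
          · simp at e₁ e₂
            exact hba (e₁.trans e₂.symm)
        · have : T ++ [b] = (x₁ ++ Q ++ x₂) ++ [e] := by simpa using hx
          have hT' := (List.append_inj' this rfl).1
          exact hQP (List.IsInfix.trans ⟨x₁, x₂, hT'.symm⟩ hTP.isInfix)

theorem isStandardPal_Pal (w : List A) : IsStandardPal (Pal w) := by
  induction w using List.reverseRecOn with
  | nil => exact isStandardPal_nil
  | append_singleton w a ih =>
    rw [Pal_append_singleton]
    exact ih.palClosure a

theorem Pal_take_succ {w : List A} {k : ℕ} (hk : k < w.length) :
    Pal (w.take (k + 1)) = palClosure (Pal (w.take k) ++ [w[k]]) := by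
  rw [List.take_succ_eq_append_getElem hk, Pal_append_singleton]

theorem Pal_take_append_isPrefix {w : List A} {k : ℕ} (hk : k < w.length) :
    Pal (w.take k) ++ [w[k]] <+: Pal (w.take (k + 1)) := by
  rw [Pal_take_succ hk]
  exact prefix_palClosure _

theorem Pal_take_isPrefix_Pal_take {w : List A} {j k : ℕ} (hjk : j ≤ k) (hk : k ≤ w.length) :
    Pal (w.take j) <+: Pal (w.take k) := by
  induction k, hjk using Nat.le_induction with
  | base => exact List.prefix_rfl
  | succ k _ ih =>
    exact (ih (by omega)).trans ((List.prefix_append _ _).trans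
      (Pal_take_append_isPrefix (by omega)))

theorem Pal_take_isPrefix {w : List A} {k : ℕ} (hk : k ≤ w.length) :
    Pal (w.take k) <+: Pal w := by
  simpa using Pal_take_isPrefix_Pal_take hk le_rfl

theorem length_Pal_take_lt {w : List A} {j k : ℕ} (hjk : j < k) (hk : k ≤ w.length) :
    (Pal (w.take j)).length < (Pal (w.take k)).length := by
  have h₁ := (Pal_take_append_isPrefix (show j < w.length by omega)).length_le
  have h₂ := (Pal_take_isPrefix_Pal_take (w := w) (show j + 1 ≤ k by omega) hk).length_le
  simp at h₁
  omega

theorem le_of_length_Pal_take_le {w : List A} {j k : ℕ} (hj : j ≤ w.length)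
    (h : (Pal (w.take j)).length ≤ (Pal (w.take k)).length) : j ≤ k := by
  by_contra! hkj
  exact absurd (length_Pal_take_lt hkj hj) (by omega)

/-- The palindromic prefixes of `Pal w` are the `Pal v` with `v` a prefix of `w`. -/
theorem exists_eq_Pal_take {w T : List A} (hT : T.reverse = T) (h : T <+: Pal w) :
    ∃ k ≤ w.length, T = Pal (w.take k) := by
  induction w using List.reverseRecOn with
  | nil =>
    refine ⟨0, le_rfl, ?_⟩
    simpa [Pal_nil] using h
  | append_singleton w a ih =>
    rw [Pal_append_singleton] at h
    rcases palPrefix_palClosure hT h with h | h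
    · obtain ⟨k, hk, rfl⟩ := ih h
      exact ⟨k, by simp; omega, by rw [List.take_append_of_le_length hk]⟩
    · exact ⟨(w ++ [a]).length, le_rfl, by rw [h, List.take_length, Pal_append_singleton]⟩

theorem lt_lastPos_iff {a : A} {w : List A} {k : ℕ} :
    k < lastPos a w ↔ ∃ j, k ≤ j ∧ w[j]? = some a := by
  unfold lastPos
  rw [Finset.lt_sup_iff]
  constructor
  · rintro ⟨j, hj, hk⟩
    -- `j` is an index from `0` and `lastPos` counts from `1`, so `k < j + 1` becomes `k ≤ j`.
    exact ⟨j, by omega, (Finset.mem_filter.mp hj).2⟩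
  · rintro ⟨j, hk, hj⟩
    refine ⟨j, Finset.mem_filter.mpr ⟨?_, hj⟩, by omega⟩
    exact Finset.mem_range.mpr (List.getElem?_eq_some_iff.mp hj).1

theorem lt_length_of_lt_lastPos {a : A} {w : List A} {k : ℕ} (h : k < lastPos a w) :
    k < w.length := by
  obtain ⟨j, hk, hj⟩ := lt_lastPos_iff.mp h
  have := (List.getElem?_eq_some_iff.mp hj).1
  omega

/-- By `exists_palPrefix` the letter also follows some prefix `Pal (w.take j)` with `j ≥ k`, so it
is `w[j]`. Conversely `Pal (w.take k)` is a suffix of each such `Pal (w.take j)`. -/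
theorem Pal_take_append_isInfix_iff {w : List A} {k : ℕ} (hk : k ≤ w.length) (a : A) :
    Pal (w.take k) ++ [a] <:+: Pal w ↔ k < lastPos a w := by
  have hs := isStandardPal_Pal w
  rw [lt_lastPos_iff]
  constructor
  · intro h
    obtain ⟨T, h₁, h₂, h₃⟩ := hs.exists_palPrefix _ a (isStandardPal_Pal _).pal
      (Pal_take_isPrefix hk) h
    obtain ⟨j, hj, rfl⟩ := exists_eq_Pal_take h₁ ((List.prefix_append _ _).trans h₃)
    refine ⟨j, le_of_length_Pal_take_le hk h₂, ?_⟩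
    have hj' : j < w.length := by
      rcases hj.lt_or_eq with hj | rfl
      · exact hj
      · have := h₃.length_le
        simp at this
    have h₄ := (Pal_take_append_isPrefix hj').trans (Pal_take_isPrefix (by omega))
    have h₅ := (List.prefix_of_prefix_length_le h₃ h₄ (by simp)).eq_of_length (by simp)
    rw [List.getElem?_eq_getElem hj']
    simpa using h₅.symm
  · rintro ⟨j, hkj, hj⟩
    obtain ⟨hjw, rfl⟩ := List.getElem?_eq_some_iff.mp hj
    have h₁ := (Pal_take_append_isPrefix hjw).trans (Pal_take_isPrefix hjw)
    obtain ⟨s, hs⟩ := isSuffix_of_isPrefix_of_reverse_eq (isStandardPal_Pal (w.take k)).pal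
      (isStandardPal_Pal (w.take j)).pal (Pal_take_isPrefix_Pal_take hkj hjw.le)
    exact List.IsInfix.trans (List.IsSuffix.isInfix ⟨s, by rw [← hs]; simp⟩) h₁.isInfix

end IteratedClosure

/-! ### Transitions of a minimal compact automaton -/

section MinimalCompactAutomaton

variable {L : Language A}

/-- As `(xv)⁻¹L = v⁻¹(x⁻¹L)`, the word chosen to represent the origin is irrelevant. -/
theorem minimalCompactAutomaton_mem_edges_iff
    {p q : {R : Language A // IsSpecialResidual L R}} {v : List A} :
    (p, v, q) ∈ (minimalCompactAutomaton L).edges ↔ v ≠ [] ∧ q.1 = p.1.leftQuotient v ∧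
      ∀ v' v'' : List A, v' ≠ [] → v'' ≠ [] → v = v' ++ v'' →
        ¬ IsSpecialResidual L (p.1.leftQuotient v') := by
  constructor
  · rintro ⟨hv, x, hp, hq, h⟩
    dsimp only at hv hp hq h
    refine ⟨hv, by rw [hq, hp, Language.leftQuotient_append], fun v' v'' h₁ h₂ h₃ h₄ => ?_⟩
    rw [hp, ← Language.leftQuotient_append] at h₄
    exact h ⟨v', v'', h₁, h₂, h₃, h₄⟩
  · rintro ⟨hv, hq, h⟩
    obtain ⟨-, x, hp, -⟩ := p.2
    refine ⟨hv, x, hp, by rw [Language.leftQuotient_append, ← hp, hq], ?_⟩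
    rintro ⟨v', v'', h₁, h₂, h₃, h₄⟩
    rw [Language.leftQuotient_append, ← hp] at h₄
    exact h v' v'' h₁ h₂ h₃ h₄

theorem IsSpecialResidual.leftQuotient_of_mem {p : Language A} (hp : IsSpecialResidual L p)
    {v : List A} (hv : v ∈ p) : IsSpecialResidual L (p.leftQuotient v) := by
  obtain ⟨-, x, rfl, -⟩ := hp
  refine ⟨⟨[], by simpa using hv⟩, x ++ v, (Language.leftQuotient_append L x v).symm, ?_⟩
  exact Or.inr (Or.inl hv)

theorem IsSpecialResidual.leftQuotient_of_branch {p : Language A}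
    (hp : IsSpecialResidual L p) {g v w : List A} {a b : A} (hab : a ≠ b)
    (ha : g ++ a :: v ∈ p) (hb : g ++ b :: w ∈ p) :
    IsSpecialResidual L (p.leftQuotient g) := by
  obtain ⟨-, x, rfl, -⟩ := hp
  exact ⟨⟨_, ha⟩, x ++ g, (Language.leftQuotient_append L x g).symm,
    Or.inr (Or.inr ⟨a, b, v, w, hab, ha, hb⟩)⟩

theorem isPrefix_or_isPrefix_or_branch (v w : List A) : v <+: w ∨ w <+: v ∨
    ∃ (g s t : List A) (a b : A), a ≠ b ∧ v = g ++ a :: s ∧ w = g ++ b :: t := by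
  induction v generalizing w with
  | nil => exact Or.inl List.nil_prefix
  | cons a v ih =>
    cases w with
    | nil => exact Or.inr (Or.inl List.nil_prefix)
    | cons b w =>
      by_cases hab : a = b
      · subst hab
        rcases ih w with h | h | ⟨g, s, t, c, d, hcd, rfl, rfl⟩
        · exact Or.inl (List.cons_prefix_cons.mpr ⟨rfl, h⟩)
        · exact Or.inr (Or.inl (List.cons_prefix_cons.mpr ⟨rfl, h⟩))
        · exact Or.inr (Or.inr ⟨a :: g, s, t, c, d, hcd, rfl, rfl⟩)
      · exact Or.inr (Or.inr ⟨[], v, w, a, b, hab, rfl, rfl⟩)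

theorem minimalCompactAutomaton_label_eq_of_isPrefix
    {p q q' : {R : Language A // IsSpecialResidual L R}} {v v' : List A}
    (h : (p, v, q) ∈ (minimalCompactAutomaton L).edges)
    (h' : (p, v', q') ∈ (minimalCompactAutomaton L).edges) (hv : v <+: v') : v = v' := by
  rw [minimalCompactAutomaton_mem_edges_iff] at h h'
  obtain ⟨t, rfl⟩ := hv
  by_contra hne
  refine h'.2.2 v t h.1 (fun ht => hne (by simp [ht])) rfl ?_
  rw [← h.2.1]
  exact q.2

/-- An edge of the minimal compact automaton is determined by its origin and the first letter
of its label. -/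
theorem minimalCompactAutomaton_injOn_edges :
    Set.InjOn (fun e : {R : Language A // IsSpecialResidual L R} × List A ×
      {R : Language A // IsSpecialResidual L R} => (e.1, e.2.1.head?))
      (minimalCompactAutomaton L).edges := by
  rintro ⟨p, v, q⟩ h ⟨p', v', q'⟩ h' heq
  simp only [Prod.mk.injEq] at heq
  obtain ⟨rfl, hhead⟩ := heq
  have hvv : v = v' := by
    rcases isPrefix_or_isPrefix_or_branch v v' with hp | hp | ⟨g, s, t, a, b, hab, rfl, rfl⟩
    · exact minimalCompactAutomaton_label_eq_of_isPrefix h h' hp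
    · exact (minimalCompactAutomaton_label_eq_of_isPrefix h' h hp).symm
    · exfalso
      rw [minimalCompactAutomaton_mem_edges_iff] at h h'
      have hg : g ≠ [] := by
        rintro rfl
        exact hab (by simpa using hhead)
      obtain ⟨x, hx⟩ := q.2.1
      obtain ⟨y, hy⟩ := q'.2.1
      rw [h.2.1, Language.mem_leftQuotient, List.append_assoc, List.cons_append] at hx
      rw [h'.2.1, Language.mem_leftQuotient, List.append_assoc, List.cons_append] at hy
      -- Where the labels diverge the residual is special, which would have cut the edge there.
      exact h.2.2 g (a :: s) hg (by simp) rfl (p.2.leftQuotient_of_branch hab hx hy)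
  subst hvv
  rw [minimalCompactAutomaton_mem_edges_iff] at h h'
  have : q = q' := Subtype.ext (h.2.1.trans h'.2.1.symm)
  rw [this]

/-- Cut `v` at special residuals passed on the way until none is left; the first letter is kept. -/
theorem minimalCompactAutomaton_exists_edge
    (p : {R : Language A // IsSpecialResidual L R}) (v : List A) (hv : v ≠ [])
    (hs : IsSpecialResidual L (p.1.leftQuotient v)) :
    ∃ v' q, v'.head? = v.head? ∧ (p, v', q) ∈ (minimalCompactAutomaton L).edges := by
  induction hl : v.length using Nat.strong_induction_on generalizing v with
  | _ l ih =>
    by_cases h : ∀ v' v'' : List A, v' ≠ [] → v'' ≠ [] → v = v' ++ v'' →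
        ¬ IsSpecialResidual L (p.1.leftQuotient v')
    · exact ⟨v, ⟨_, hs⟩, rfl, minimalCompactAutomaton_mem_edges_iff.mpr ⟨hv, rfl, h⟩⟩
    · push Not at h
      obtain ⟨v', v'', h₁, h₂, rfl, h₃⟩ := h
      have := List.length_pos_iff.mpr h₂
      obtain ⟨w, q, hw, hq⟩ := ih v'.length (by simp at hl; omega) v' h₁ h₃ rfl
      exact ⟨w, q, by rw [hw, List.head?_append_of_ne_nil _ h₁], hq⟩

/-- With `minimalCompactAutomaton_injOn_edges` this reduces counting edges to counting pairs. A word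
of a state leads to a terminal, hence special, residual, so an edge with its first letter exists. -/
theorem minimalCompactAutomaton_image_edges :
    (fun e : {R : Language A // IsSpecialResidual L R} × List A ×
      {R : Language A // IsSpecialResidual L R} => (e.1, e.2.1.head?)) ''
      (minimalCompactAutomaton L).edges =
    {x | ∃ c t, x.2 = some c ∧ c :: t ∈ x.1.1} := by
  ext ⟨p, o⟩
  constructor
  · rintro ⟨⟨p, v, q⟩, h, heq⟩
    simp only [Prod.mk.injEq] at heq
    obtain ⟨rfl, rfl⟩ := heq
    rw [minimalCompactAutomaton_mem_edges_iff] at h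
    obtain ⟨c, s, rfl⟩ := List.exists_cons_of_ne_nil h.1
    obtain ⟨w, hw⟩ := q.2.1
    rw [h.2.1] at hw
    exact ⟨c, s ++ w, rfl, hw⟩
  · rintro ⟨c, t, ho, ht⟩
    obtain ⟨v, q, hv, he⟩ := minimalCompactAutomaton_exists_edge p (c :: t) (by simp)
      (p.2.leftQuotient_of_mem ht)
    exact ⟨_, he, Prod.ext rfl (by simpa [hv] using ho.symm)⟩

end MinimalCompactAutomaton

/-! ### Counting for `Pal w` -/

section CompactSuffixAutomaton

variable [DecidableEq A]

/-- The special residuals of the suffixes of `Pal w` are those by palindromic prefixes. -/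
theorem isSpecialResidual_suffixLanguage_Pal_iff {w : List A} {R : Language A} :
    IsSpecialResidual (suffixLanguage (Pal w)) R ↔
      ∃ k ≤ w.length, R = (suffixLanguage (Pal w)).leftQuotient (Pal (w.take k)) := by
  have hP := isStandardPal_Pal w
  constructor
  · rintro ⟨-, x, rfl, hx⟩
    have hxs : x <:+ Pal w := by
      rcases hx with rfl | hx | ⟨a, b, s, t, hab, ha, hb⟩
      · exact List.nil_suffix
      · exact hx
      · have ha' : x ++ a :: s <:+ Pal w := ha
        have hb' : x ++ b :: t <:+ Pal w := hb
        refine hP.isSuffix_of_special x a b hab (List.IsInfix.trans ?_ ha'.isInfix)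
          (List.IsInfix.trans ?_ hb'.isInfix)
        · exact ⟨[], s, by simp⟩
        · exact ⟨[], t, by simp⟩
    obtain ⟨T, h₁, h₂, ⟨r, hr⟩, h₄⟩ := hP.exists_isSuffix_append hxs
    obtain ⟨k, hk, rfl⟩ := exists_eq_Pal_take h₁
      (isPrefix_of_isSuffix_of_reverse_eq h₁ hP.pal h₂)
    refine ⟨k, hk, ?_⟩
    ext v
    change x ++ v <:+ Pal w ↔ Pal (w.take k) ++ v <:+ Pal w
    constructor
    · rintro ⟨α, hα⟩
      obtain ⟨s, hs⟩ := h₄ α v (by simpa using hα)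
      exact ⟨s, by rw [← List.append_assoc, hs]; simpa using hα⟩
    · exact fun h => List.IsSuffix.trans ⟨r, by simp [← hr]⟩ h
  · rintro ⟨k, hk, rfl⟩
    have hs : Pal (w.take k) <:+ Pal w :=
      isSuffix_of_isPrefix_of_reverse_eq (isStandardPal_Pal _).pal hP.pal (Pal_take_isPrefix hk)
    refine ⟨⟨[], ?_⟩, _, rfl, Or.inr (Or.inl hs)⟩
    rw [Language.mem_leftQuotient, List.append_nil]
    exact hs

/-- The state of the compact suffix automaton of `Pal w` given by `Pal (w.take k)`. -/
def palState (w : List A) (k : ℕ) :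
    {R : Language A // IsSpecialResidual (suffixLanguage (Pal w)) R} :=
  ⟨(suffixLanguage (Pal w)).leftQuotient (Pal (w.take k)),
    isSpecialResidual_suffixLanguage_Pal_iff.mpr
      -- Values of `k` beyond `w.length` repeat the last state.
      ⟨min k w.length, min_le_right _ _, by rw [← List.take_eq_take_min]⟩⟩

/-- The residual by a prefix `T` of `Pal w` contains a word of length `|Pal w| - |T|`, and no
residual by a longer word does. -/
theorem le_of_palState_eq {w : List A} {j k : ℕ} (hj : j ≤ w.length) (hk : k ≤ w.length)
    (h : palState w j = palState w k) : k ≤ j := by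
  obtain ⟨v, hv⟩ := Pal_take_isPrefix hj
  have h₁ : v ∈ (palState w j).1 := by
    change Pal (w.take j) ++ v <:+ Pal w
    rw [hv]
  rw [h] at h₁
  have h₂ : Pal (w.take k) ++ v <:+ Pal w := h₁
  have h₃ := h₂.length_le
  rw [← hv] at h₃
  exact le_of_length_Pal_take_le hk (by simpa using h₃)

theorem palState_inj {w : List A} {j k : ℕ} (hj : j ≤ w.length) (hk : k ≤ w.length)
    (h : palState w j = palState w k) : j = k :=
  le_antisymm (le_of_palState_eq hk hj h.symm) (le_of_palState_eq hj hk h)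

theorem exists_eq_palState {w : List A}
    (p : {R : Language A // IsSpecialResidual (suffixLanguage (Pal w)) R}) :
    ∃ k ≤ w.length, p = palState w k := by
  obtain ⟨k, hk, h⟩ := isSpecialResidual_suffixLanguage_Pal_iff.mp p.2
  exact ⟨k, hk, Subtype.ext h⟩

theorem exists_cons_mem_palState_iff {w : List A} {k : ℕ} (hk : k ≤ w.length) (c : A) :
    (∃ t, c :: t ∈ (palState w k).1) ↔ k < lastPos c w := by
  rw [← Pal_take_append_isInfix_iff hk]
  constructor
  · rintro ⟨t, s, hs⟩
    exact ⟨s, t, by simpa using hs⟩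
  · rintro ⟨s, t, hs⟩
    exact ⟨t, s, by simpa using hs⟩

theorem numStates_compactSuffixAutomaton (w : List A) :
    (compactSuffixAutomaton w).numStates = ((w.length + 1 : ℕ) : ℕ∞) := by
  have hb : Function.Bijective (fun k : Fin (w.length + 1) => palState w k) := by
    refine ⟨fun j k h => Fin.ext (palState_inj (by omega) (by omega) h), fun p => ?_⟩
    obtain ⟨k, hk, rfl⟩ := exists_eq_palState p
    exact ⟨⟨k, by omega⟩, rfl⟩
  rw [CompactAutomaton.numStates, ← ENat.card_congr (Equiv.ofBijective _ hb)]
  simp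

theorem numTransitions_compactSuffixAutomaton (w : List A) :
    (compactSuffixAutomaton w).numTransitions = ((∑ᶠ a : A, lastPos a w : ℕ) : ℕ∞) := by
  -- Pairs (first letter `a`, origin `k`) with `k < lastPos a w` index the transitions.
  let D : Finset (Σ _ : A, ℕ) := w.toFinset.sigma fun a => Finset.range (lastPos a w)
  let g : (Σ _ : A, ℕ) →
      {R : Language A // IsSpecialResidual (suffixLanguage (Pal w)) R} × Option A :=
    fun x => (palState w x.2, some x.1)
  have hD : ∀ a k, (⟨a, k⟩ : Σ _ : A, ℕ) ∈ D ↔ k < lastPos a w := by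
    intro a k
    simp only [D, Finset.mem_sigma, Finset.mem_range, List.mem_toFinset, and_iff_right_iff_imp]
    intro h
    by_contra ha
    rw [lastPos_eq_zero ha] at h
    omega
  have hg : Set.InjOn g D := by
    rintro ⟨a, j⟩ hj ⟨b, k⟩ hk h
    rw [Finset.mem_coe, hD] at hj hk
    simp only [g, Prod.mk.injEq, Option.some.injEq] at h
    obtain ⟨h, rfl⟩ := h
    rw [palState_inj (lt_length_of_lt_lastPos hj).le (lt_length_of_lt_lastPos hk).le h]
  have himage : g '' D = {x | ∃ c t, x.2 = some c ∧ c :: t ∈ x.1.1} := by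
    ext ⟨p, o⟩
    constructor
    · rintro ⟨⟨a, k⟩, hk, h⟩
      rw [Finset.mem_coe, hD] at hk
      obtain ⟨t, ht⟩ :=
        (exists_cons_mem_palState_iff (lt_length_of_lt_lastPos hk).le a).mpr hk
      rw [← h]
      exact ⟨a, t, rfl, ht⟩
    · rintro ⟨c, t, ho, ht⟩
      dsimp only at ho ht
      subst ho
      obtain ⟨k, hk, rfl⟩ := exists_eq_palState p
      exact ⟨⟨c, k⟩, (hD c k).mpr ((exists_cons_mem_palState_iff hk c).mp ⟨t, ht⟩), rfl⟩
  rw [CompactAutomaton.numTransitions, compactSuffixAutomaton,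
    ← minimalCompactAutomaton_injOn_edges.encard_image, minimalCompactAutomaton_image_edges,
    ← himage, hg.encard_image, Set.encard_coe_eq_coe_finsetCard, Finset.card_sigma]
  rw [finsum_eq_sum_of_support_subset (s := w.toFinset)]
  · simp
  · intro a ha
    by_contra h
    exact ha (lastPos_eq_zero (by simpa using h))

end CompactSuffixAutomaton

end PalAutomaton

theorem mainTheorem7 {A : Type*} [DecidableEq A] (u : List A) (n : ℕ) (hn : u.length = n) :
    (PalAutomaton.compactSuffixAutomaton u).numStates = ((n + 1 : ℕ) : ℕ∞) ∧
    (PalAutomaton.compactSuffixAutomaton u).numTransitions =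
      ((∑ᶠ a : A, PalAutomaton.lastPos a u : ℕ) : ℕ∞) := by
  subst hn
  exact ⟨PalAutomaton.numStates_compactSuffixAutomaton u,
    PalAutomaton.numTransitions_compactSuffixAutomaton u⟩
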